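/- Let $n,m\ge 0$ be integers, let $J,R,Q\in\mathbb R^{n\times n}$, $B,P\in\mathbb R^{n\times m}$, $D\in\mathbb R^{m\times m}$ satisfy $$J=-J^\top,\quad R=R^\top\ge 0,\quad Q=Q^\top\ge 0,\quad S:=\tfrac12(D+D^\top)\ge 0,\quad \begin{pmatrix}QRQ & QP\\ P^\top Q & S\end{pmatrix}\ge 0,$$ and consider the port-Hamiltonian ODE system $$\dot x=(J-R)Qx+(B-P)u,\qquad y=(B+P)^\top Qx+Du.$$ Let $\mathbb U\subset\mathbb R^m$ be convex and compact with $0\in\operatorname{int}\mathbb U$. For $t\ge 0$, a state $z\in\mathbb R^n$ is reachable from $x^0\in\mathbb R^n$ at time $t$ if there is a control $u\in L^1(0,t;\mathbb U)$ such that the solution of the state equation with $x(0)=x^0$ satisfies $x(t)=z$ (for $t=0$ this means $z=x^0$). Let $\mathcal C(z)$ be the set of all $x^0$ from which $z$ is reachable at some time $t\ge 0$, and for $x^0\in\mathcal C(z)$ let $T(x^0;z)$ be the minimal time $t\ge 0$ at which $z$ is reachable from $x^0$. For $A\in\mathbb R^{n\times n}$ and $\widetilde B\in\mathbb R^{n\times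 m}$ let $K(A,\widetilde B)=(\widetilde B,A\widetilde B,\ldots,A^{n-1}\widetilde B)$ be the Kalman matrix. Let $(\bar x_e,\bar u_e)\in\mathbb R^n\times\operatorname{int}\mathbb U$ be a steady state, that is, $(J-R)Q\bar x_e+(B-P)\bar u_e=0$. Then: (i) $\mathcal C(\bar x_e)=\bar x_e+\operatorname{im}K\big((J-R)Q,\,B-P\big)$. (ii) For every $x^0\in\mathcal C(\bar x_e)$ the minimal time $T(x^0;\bar x_e)$ exists (the infimum of the times $t \ge 0$ at which $\bar x_e$ is reachable from $x^0$ is attained), and the minimal time function $T(\,\cdot\,;\bar x_e):\mathcal C(\bar x_e)\to[0,\infty)$ is continuous. -/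

import Mathlib

open scoped Matrix

namespace PHControl

/-- The data of a port-Hamiltonian ODE system with feed-through,
`x' = (J - R) Q x + (B - P) u`, `y = (B + P)ᵀ Q x + D u`,
with state space `ℝⁿ`, input and output space `ℝᵐ`, and constant real matrices. -/
structure PHSystem (n m : ℕ) where
  J : Matrix (Fin n) (Fin n) ℝ
  R : Matrix (Fin n) (Fin n) ℝ
  Q : Matrix (Fin n) (Fin n) ℝ
  B : Matrix (Fin n) (Fin m) ℝ
  P : Matrix (Fin n) (Fin m) ℝ
  D : Matrix (Fin m) (Fin m) ℝ
  J_skew : J = -Jᵀ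
  R_psd : R.PosSemidef
  Q_psd : Q.PosSemidef
  S_psd : ((1 / 2 : ℝ) • (D + Dᵀ)).PosSemidef
  W_psd : (Matrix.fromBlocks (Q * R * Q) (Q * P) (Pᵀ * Q) ((1 / 2 : ℝ) • (D + Dᵀ))).PosSemidef

variable {n m : ℕ}

/-- The drift matrix `(J - R) Q`. -/
def PHSystem.drift (sys : PHSystem n m) : Matrix (Fin n) (Fin n) ℝ :=
  (sys.J - sys.R) * sys.Q

/-- The input matrix `B - P` of the state equation. -/
def PHSystem.input (sys : PHSystem n m) : Matrix (Fin n) (Fin m) ℝ :=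
  sys.B - sys.P

/-- The Kalman matrix `K(A, B) = (B, A B, …, A^(n-1) B)`; the columns are indexed by pairs
`(k, j)`, where `k < n` is the number of the block and `j` the column within the block. -/
def kalmanMatrix (A : Matrix (Fin n) (Fin n) ℝ) (B : Matrix (Fin n) (Fin m) ℝ) :
    Matrix (Fin n) (Fin n × Fin m) ℝ :=
  Matrix.of fun i p => (A ^ (p.1 : ℕ) * B) i p.2

/-- `u` (represents an element which) belongs to `L¹(0, t; U)`. -/
def IsControl (U : Set (Fin m → ℝ)) (t : ℝ) (u : ℝ → Fin m → ℝ) : Prop :=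
  MeasureTheory.IntegrableOn u (Set.Ioo 0 t) ∧
    ∀ᵐ s ∂(MeasureTheory.volume.restrict (Set.Ioo 0 t)), u s ∈ U

/-- `x` is, on `[0, t]`, the (Carathéodory) solution of `x' = A x + B u`, `x(0) = x₀`:
it is continuous and satisfies the integrated equation. -/
def IsTrajectory (A : Matrix (Fin n) (Fin n) ℝ) (B : Matrix (Fin n) (Fin m) ℝ)
    (t : ℝ) (u : ℝ → Fin m → ℝ) (x₀ : Fin n → ℝ) (x : ℝ → Fin n → ℝ) : Prop :=
  ContinuousOn x (Set.Icc 0 t) ∧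
    ∀ s ∈ Set.Icc 0 t, x s = x₀ + ∫ τ in (0 : ℝ)..s, (A *ᵥ x τ + B *ᵥ u τ)

/-- The state `z` is reachable from the state `x₀` at time `t ≥ 0`
with a control in `L¹(0, t; U)`. -/
def PHSystem.Reachable (sys : PHSystem n m) (U : Set (Fin m → ℝ)) (t : ℝ)
    (x₀ z : Fin n → ℝ) : Prop :=
  0 ≤ t ∧ ∃ (u : ℝ → Fin m → ℝ) (x : ℝ → Fin n → ℝ),
    IsControl U t u ∧ IsTrajectory sys.drift sys.input t u x₀ x ∧ x t = z

/-- The set of all states that can be steered to `z` at some time `t ≥ 0`. -/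
def PHSystem.steerableTo (sys : PHSystem n m) (U : Set (Fin m → ℝ)) (z : Fin n → ℝ) :
    Set (Fin n → ℝ) :=
  {x₀ | ∃ t : ℝ, sys.Reachable U t x₀ z}

/-- The minimal time in which `x₀` can be steered to `z`. -/
noncomputable def PHSystem.minTime (sys : PHSystem n m) (U : Set (Fin m → ℝ))
    (z x₀ : Fin n → ℝ) : ℝ :=
  sInf {t : ℝ | sys.Reachable U t x₀ z}

/-- `(xe, ue)` is a steady state of the state equation, for the control constraint set `U`. -/
def PHSystem.IsSteadyState (sys : PHSystem n m) (U : Set (Fin m → ℝ))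
    (xe : Fin n → ℝ) (ue : Fin m → ℝ) : Prop :=
  ue ∈ U ∧ sys.drift *ᵥ xe + sys.input *ᵥ ue = 0

end PHControl

/-! Subtracting the steady state turns the problem into steering `x₀ - xe` to the origin along `z' =
A z + B v`, with `v` in the convex compact set `V = U - ue`, a neighbourhood of 0. By variation of
constants, the states steered to 0 in time `t` form the convex set `nullSet A B V t` of all `-∫₀ᵗ
exp(-sA) B v(s) ds`.

These sets lie in the Kalman subspace `K` (`nullSet_subset`) and, for `t > 0`, contain a ball of `K`
(`exists_ball_subset_nullSet`). They exhaust `K` because of dissipation: the energy `xᵀ Q x` bounds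
the velocity `(J - R) Q x` of a free trajectory, so the state grows at most linearly
(`exists_norm_flow_drift_le`), and a divergent harmonic sum of small corrections removes it
(`exists_mem_nullSet`).

The sets increase with `t`, are closed (`isClosed_nullSet`), and are continuous from the right
(`mem_nullSet_of_forall_gt`), so the infimum of the times is attained. Closedness gives lower
semicontinuity of the minimal time; the balls in `K` give upper semicontinuity. -/

open MeasureTheory Set Filter Topology intervalIntegral

namespace LinearControl

/-! ### Product rule for absolutely continuous curves -/

section ProductRule

variable {E : Type*} [NormedAddCommGroup E] [NormedSpace ℝ E]

lemma absolutelyContinuousOnInterval_of_dist_le {X Y : Type*} [PseudoMetricSpace X]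
    [PseudoMetricSpace Y] {f : ℝ → X} {g : ℝ → Y} {a b K L : ℝ}
    (hg : AbsolutelyContinuousOnInterval g a b)
    (h : ∀ x ∈ uIcc a b, ∀ y ∈ uIcc a b, dist (f x) (f y) ≤ K * dist (g x) (g y) + L * dist x y) :
    AbsolutelyContinuousOnInterval f a b := by
  have hid : AbsolutelyContinuousOnInterval (fun x : ℝ => x) a b := by
    unfold AbsolutelyContinuousOnInterval
    exact tendsto_comap.mono_left inf_le_left
  unfold AbsolutelyContinuousOnInterval at hg hid ⊢
  refine squeeze_zero' (Eventually.of_forall fun _ => Finset.sum_nonneg fun _ _ => dist_nonneg) ?_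
    (by simpa using (hg.const_mul K).add (hid.const_mul L))
  refine eventually_inf_principal.2 (Eventually.of_forall fun I hI => ?_)
  rw [Finset.mul_sum, Finset.mul_sum, ← Finset.sum_add_distrib]
  refine Finset.sum_le_sum fun i hi => ?_
  have := hI.1 i hi
  exact h _ this.1 _ this.2

lemma absolutelyContinuousOnInterval_integral {g : ℝ → E} {t : ℝ}
    (hg : IntervalIntegrable g volume 0 t) :
    AbsolutelyContinuousOnInterval (fun s => ∫ τ in (0 : ℝ)..s, g τ) 0 t := by
  have h := hg.norm.absolutelyContinuousOnInterval_intervalIntegral (c := 0) (by simp)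
  refine absolutelyContinuousOnInterval_of_dist_le (K := 1) (L := 0) h fun x hx y hy => ?_
  have hx' : IntervalIntegrable g volume 0 x := hg.mono_set (uIcc_subset_uIcc_left hx)
  have hy' : IntervalIntegrable g volume 0 y := hg.mono_set (uIcc_subset_uIcc_left hy)
  rw [dist_eq_norm, Real.dist_eq, integral_interval_sub_left hx' hy',
    integral_interval_sub_left hx'.norm hy'.norm, zero_mul, add_zero, one_mul]
  exact norm_integral_le_abs_integral_norm

/-- The difference of the two sides, as a function of the upper limit, is absolutely continuous with
derivative zero almost everywhere, hence constant. Taking `M s = exp(∓sA)` yields both directions of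
variation of constants for merely integrable data. -/
lemma clm_apply_integral_eq {M M' : ℝ → E →L[ℝ] E} {g : ℝ → E} {c : E} {t : ℝ} [CompleteSpace E]
    (hM : ∀ s, HasDerivAt M (M' s) s) (hM' : Continuous M') (hg : IntervalIntegrable g volume 0 t) :
    M t (c + ∫ τ in (0 : ℝ)..t, g τ) =
      M 0 c + ∫ s in (0 : ℝ)..t, (M' s (c + ∫ τ in (0 : ℝ)..s, g τ) + M s (g s)) := by
  have hMc : Continuous M := continuous_iff_continuousAt.2 fun s => (hM s).continuousAt
  set w : ℝ → E := fun s => c + ∫ τ in (0 : ℝ)..s, g τ with hw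
  have hwac : AbsolutelyContinuousOnInterval w 0 t := by
    refine absolutelyContinuousOnInterval_of_dist_le (K := 1) (L := 0)
      (absolutelyContinuousOnInterval_integral hg) fun x _ y _ => ?_
    simp [hw]
  have hwc : ContinuousOn w (uIcc 0 t) := hwac.continuousOn
  obtain ⟨K, hK⟩ := isCompact_uIcc.exists_bound_of_continuousOn (s := uIcc 0 t) hMc.continuousOn
  obtain ⟨K', hK'⟩ := isCompact_uIcc.exists_bound_of_continuousOn (s := uIcc 0 t) hM'.continuousOn
  obtain ⟨W, hW⟩ := isCompact_uIcc.exists_bound_of_continuousOn hwc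
  have hMlip : ∀ x ∈ uIcc 0 t, ∀ y ∈ uIcc 0 t, ‖M x - M y‖ ≤ K' * ‖x - y‖ := fun x hx y hy =>
    (convex_uIcc 0 t).norm_image_sub_le_of_norm_hasDerivWithin_le
      (fun z _ => (hM z).hasDerivWithinAt) hK' hy hx
  have hpac : AbsolutelyContinuousOnInterval (fun s => M s (w s)) 0 t := by
    refine absolutelyContinuousOnInterval_of_dist_le (K := K) (L := K' * W) hwac
      fun x hx y hy => ?_
    rw [dist_eq_norm, dist_eq_norm, dist_eq_norm]
    have : M x (w x) - M y (w y) = M x (w x - w y) + (M x - M y) (w y) := by simp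
    rw [this]
    refine (norm_add_le _ _).trans (add_le_add ?_ ?_)
    · exact ((M x).le_opNorm _).trans (by gcongr; exact hK x hx)
    · refine ((M x - M y).le_opNorm _).trans ?_
      have h1 := hMlip x hx y hy
      have h2 := hW y hy
      calc ‖M x - M y‖ * ‖w y‖ ≤ (K' * ‖x - y‖) * W := by gcongr; exact (norm_nonneg _).trans h1
        _ = _ := by ring
  have hint : IntervalIntegrable (fun s => M' s (w s) + M s (g s)) volume 0 t := by
    refine (ContinuousOn.intervalIntegrable (hM'.continuousOn.clm_apply hwc)).add ?_
    rw [intervalIntegrable_iff] at hg ⊢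
    refine Integrable.mono' (hg.norm.const_mul K)
      ((ContinuousLinearMap.id ℝ (E →L[ℝ] E)).aestronglyMeasurable_comp₂
        hMc.aestronglyMeasurable hg.aestronglyMeasurable) ?_
    refine (ae_restrict_iff' measurableSet_uIoc).2 (Eventually.of_forall fun s hs => ?_)
    exact ((M s).le_opNorm _).trans (by gcongr; exact hK s (uIoc_subset_uIcc hs))
  have hqac := absolutelyContinuousOnInterval_integral hint
  obtain ⟨C, hC⟩ := (hpac.sub hqac).const_of_ae_hasDerivAt_zero (by
    filter_upwards [hg.ae_hasDerivAt_integral, hint.ae_hasDerivAt_integral] with s h1 h2 hs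
    have h3 := ((hM s).clm_apply ((h1 hs 0 (by simp)).const_add c)).sub (h2 hs 0 (by simp))
    simpa [hw] using h3)
  have h0 := hC 0 (by simp)
  have h1 := hC t (by simp)
  simp only [Pi.sub_apply, integral_same, sub_zero] at h0 h1
  rw [← h0, sub_eq_iff_eq_add] at h1
  simpa [hw] using h1

end ProductRule

/-! ### The exponential flow -/

section Flow

variable {E : Type*} [NormedAddCommGroup E] [NormedSpace ℝ E] [CompleteSpace E]

/-- The flow `s ↦ exp (s A)` of the linear equation `x' = A x`. -/
noncomputable def flow (A : E →L[ℝ] E) (s : ℝ) : E →L[ℝ] E := NormedSpace.exp (s • A)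

lemma hasDerivAt_flow (A : E →L[ℝ] E) (s : ℝ) : HasDerivAt (flow A) (A * flow A s) s :=
  hasDerivAt_exp_smul_const' A s

lemma hasDerivAt_flow_neg (A : E →L[ℝ] E) (s : ℝ) :
    HasDerivAt (fun s => flow A (-s)) (-(flow A (-s) * A)) s := by
  have h : HasDerivAt (flow A) (flow A (-s) * A) (-s) := hasDerivAt_exp_smul_const A (-s)
  have h' := h.scomp s (hasDerivAt_neg s)
  rw [neg_one_smul] at h'
  exact h'

lemma continuous_flow (A : E →L[ℝ] E) : Continuous (flow A) :=
  continuous_iff_continuousAt.2 fun s => (hasDerivAt_flow A s).continuousAt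

omit [CompleteSpace E] in
@[simp] lemma flow_zero (A : E →L[ℝ] E) : flow A 0 = 1 := by simp [flow]

lemma flow_add (A : E →L[ℝ] E) (s t : ℝ) : flow A (s + t) = flow A s * flow A t := by
  let : NormedAlgebra ℚ (E →L[ℝ] E) := NormedAlgebra.restrictScalars ℚ ℝ _
  rw [flow, add_smul, NormedSpace.exp_add_of_commute]
  · rfl
  · exact ((Commute.refl A).smul_left s).smul_right t

@[simp] lemma flow_apply_flow_neg (A : E →L[ℝ] E) (s : ℝ) (x : E) :
    flow A s (flow A (-s) x) = x := by
  rw [← mul_apply_eq_comp, ← flow_add]; simp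

@[simp] lemma flow_neg_apply_flow (A : E →L[ℝ] E) (s : ℝ) (x : E) :
    flow A (-s) (flow A s x) = x := by
  rw [← mul_apply_eq_comp, ← flow_add]; simp

lemma flow_mem [FiniteDimensional ℝ E] {A : E →L[ℝ] E} {K : Submodule ℝ E}
    (hA : ∀ x ∈ K, A x ∈ K) (s : ℝ) {x : E} (hx : x ∈ K) : flow A s x ∈ K := by
  have h := NormedSpace.exp_series_hasSum_exp' (𝕂 := ℝ) (s • A)
  have h' := (ContinuousLinearMap.apply ℝ E x).hasSum h
  have hpow : ∀ k : ℕ, (A ^ k) x ∈ K := by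
    intro k
    induction k with
    | zero => simpa using hx
    | succ k ih => rw [pow_succ']; exact hA _ ih
  refine K.closed_of_finiteDimensional.mem_of_tendsto h' (Eventually.of_forall fun S => ?_)
  refine K.sum_mem fun k _ => ?_
  simp only [ContinuousLinearMap.apply_apply, smul_pow, smul_apply]
  exact K.smul_mem _ (K.smul_mem _ (hpow k))

end Flow

/-! ### Null-controllable sets and local controllability -/

section NullControllable

variable {E F : Type*} [NormedAddCommGroup E] [NormedSpace ℝ E] [CompleteSpace E]
  [NormedAddCommGroup F] [NormedSpace ℝ F] [FiniteDimensional ℝ F] [MeasurableSpace F]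
  [BorelSpace F]

/-- A measurable control with values in the constraint set `V`. -/
structure IsAdmissible (V : Set F) (v : ℝ → F) : Prop where
  measurable : Measurable v
  mem : ∀ s, v s ∈ V

lemma IsAdmissible.integrableOn {V : Set F} (hV : Bornology.IsBounded V) {v : ℝ → F}
    (hv : IsAdmissible V v) {s : Set ℝ} (hs : volume s ≠ ⊤) : IntegrableOn v s := by
  have := FiniteDimensional.proper ℝ F
  obtain ⟨C, hC⟩ := hV.exists_norm_le
  exact Measure.integrableOn_of_bounded hs hv.measurable.aestronglyMeasurable
    (Eventually.of_forall fun s => hC _ (hv.mem s))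

omit [CompleteSpace E] in
lemma IsAdmissible.intervalIntegrable {V : Set F} (hV : Bornology.IsBounded V) {v : ℝ → F}
    (hv : IsAdmissible V v) {G : ℝ → F →L[ℝ] E} (hG : Continuous G) (a b : ℝ) :
    IntervalIntegrable (fun s => G s (v s)) volume a b := by
  obtain ⟨C, hC⟩ := isCompact_uIcc.exists_bound_of_continuousOn (s := uIcc a b) hG.continuousOn
  have h : IntegrableOn v (uIoc a b) := hv.integrableOn hV (by simp [uIoc])
  rw [intervalIntegrable_iff]
  refine Integrable.mono' (h.norm.const_mul C)
    ((ContinuousLinearMap.id ℝ (F →L[ℝ] E)).aestronglyMeasurable_comp₂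
      hG.aestronglyMeasurable h.aestronglyMeasurable) ?_
  refine (ae_restrict_iff' measurableSet_uIoc).2 (Eventually.of_forall fun s hs => ?_)
  exact ((G s).le_opNorm _).trans (by gcongr; exact hC s (uIoc_subset_uIcc hs))

/-- The response `s ↦ exp (-s A) B` of the backward flow to an input at time `s`. -/
noncomputable def response (A : E →L[ℝ] E) (B : F →L[ℝ] E) (s : ℝ) : F →L[ℝ] E :=
  (flow A (-s)).comp B

omit [FiniteDimensional ℝ F] [MeasurableSpace F] [BorelSpace F] in
lemma continuous_response (A : E →L[ℝ] E) (B : F →L[ℝ] E) : Continuous (response A B) :=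
  ((continuous_flow A).comp continuous_neg).clm_comp continuous_const

/-- The states which admissible controls steer to the origin in time `t`
along `x' = A x + B v`. -/
def nullSet (A : E →L[ℝ] E) (B : F →L[ℝ] E) (V : Set F) (t : ℝ) : Set E :=
  {z | ∃ v, IsAdmissible V v ∧ z = -∫ s in (0 : ℝ)..t, response A B s (v s)}

variable {A : E →L[ℝ] E} {B : F →L[ℝ] E} {V : Set F}

omit [CompleteSpace E] [FiniteDimensional ℝ F] [BorelSpace F] in
lemma zero_mem_nullSet (h0 : 0 ∈ V) (t : ℝ) : (0 : E) ∈ nullSet A B V t :=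
  ⟨fun _ => 0, ⟨measurable_const, fun _ => h0⟩, by simp⟩

lemma convex_nullSet (hV : Convex ℝ V) (hVb : Bornology.IsBounded V) (t : ℝ) :
    Convex ℝ (nullSet A B V t) := by
  have := FiniteDimensional.proper ℝ F
  rintro x ⟨v, hv, rfl⟩ y ⟨w, hw, rfl⟩ a b ha hb hab
  refine ⟨fun s => a • v s + b • w s, ⟨(hv.measurable.const_smul a).add
    (hw.measurable.const_smul b), fun s => hV (hv.mem s) (hw.mem s) ha hb hab⟩, ?_⟩
  have h1 := hv.intervalIntegrable hVb (continuous_response A B) 0 t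
  have h2 := hw.intervalIntegrable hVb (continuous_response A B) 0 t
  simp only [map_add, map_smul]
  have h3 := integral_add (h1.smul a) (h2.smul b)
  simp only [Pi.smul_apply] at h3
  rw [h3, intervalIntegral.integral_smul,
    intervalIntegral.integral_smul]
  simp only [smul_neg, neg_add]

/-- Concatenation of controls: the second one, delayed by `s`, contributes its integral pulled back
by `exp(-sA)`. -/
lemma add_flow_mem_nullSet (hVb : Bornology.IsBounded V) {s t : ℝ} (hs : 0 ≤ s) (ht : 0 ≤ t)
    {x y : E} (hx : x ∈ nullSet A B V s) (hy : y ∈ nullSet A B V t) :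
    x + flow A (-s) y ∈ nullSet A B V (s + t) := by
  obtain ⟨v, hv, rfl⟩ := hx
  obtain ⟨w, hw, rfl⟩ := hy
  have hu : IsAdmissible V (fun τ => if τ ≤ s then v τ else w (τ - s)) := by
    refine ⟨Measurable.ite measurableSet_Iic hv.measurable
      (hw.measurable.comp (measurable_id.sub_const s)), fun τ => ?_⟩
    split_ifs
    exacts [hv.mem _, hw.mem _]
  have hi := fun a b => hu.intervalIntegrable hVb (continuous_response A B) a b
  refine ⟨_, hu, ?_⟩
  rw [← integral_add_adjacent_intervals (hi 0 s) (hi s (s + t)), neg_add, map_neg]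
  congr 2
  · refine integral_congr fun τ hτ => ?_
    rw [uIcc_of_le hs] at hτ
    simp [hτ.2]
  · rw [← ContinuousLinearMap.intervalIntegral_comp_comm _
      (hw.intervalIntegrable hVb (continuous_response A B) 0 t)]
    have := integral_comp_add_right (a := 0) (b := t)
      (fun τ => response A B τ (if τ ≤ s then v τ else w (τ - s))) s
    rw [zero_add, add_comm t s] at this
    rw [← this]
    refine integral_congr_ae (Eventually.of_forall fun τ hτ => ?_)
    rw [uIoc_of_le ht] at hτ
    have h1 : ¬ τ + s ≤ s := by linarith [hτ.1]
    simp only [h1, if_false, add_sub_cancel_right, response, ContinuousLinearMap.comp_apply]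
    rw [← mul_apply_eq_comp, ← flow_add]
    congr 2
    ring

lemma nullSet_mono (hVb : Bornology.IsBounded V) (h0 : 0 ∈ V) {s t : ℝ} (hs : 0 ≤ s)
    (hst : s ≤ t) : nullSet A B V s ⊆ nullSet A B V t := fun x hx => by
  have := add_flow_mem_nullSet hVb hs (sub_nonneg.2 hst) hx
    (zero_mem_nullSet (A := A) (B := B) h0 (t - s))
  simpa using this

/-- A functional that vanishes on `K` but not on the integral would contradict the vanishing of the
integrand under it. -/
lemma nullSet_subset [FiniteDimensional ℝ E] (hVb : Bornology.IsBounded V) {K : Submodule ℝ E}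
    (hA : ∀ x ∈ K, A x ∈ K) (hB : ∀ u, B u ∈ K) (t : ℝ) : nullSet A B V t ⊆ K := by
  rintro _ ⟨v, hv, rfl⟩
  refine K.neg_mem ?_
  by_contra hn
  obtain ⟨η, hη, hK⟩ := Submodule.exists_le_ker_of_notMem hn
  have := ContinuousLinearMap.intervalIntegral_comp_comm (LinearMap.toContinuousLinearMap η)
      (hv.intervalIntegrable hVb (continuous_response A B) 0 t)
  refine hη ?_
  rw [← LinearMap.coe_toContinuousLinearMap' η, ← this]
  refine (integral_congr fun s _ => ?_).trans integral_zero
  exact hK (flow_mem hA _ (hB _))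

/-- Differentiate `k` times in `s`, then let `s` tend to 0. -/
lemma apply_pow_eq_zero_of_flow_neg {η : E →L[ℝ] ℝ} {t : ℝ} (ht : 0 < t)
    {b : E} (h : ∀ s ∈ Ioo 0 t, η (flow A (-s) b) = 0) (k : ℕ) : η ((A ^ k) b) = 0 := by
  have hk : ∀ k : ℕ, ∀ s ∈ Ioo 0 t, η (flow A (-s) ((A ^ k) b)) = 0 := by
    intro k
    induction k with
    | zero => simpa using h
    | succ k ih =>
      intro s hs
      have h1 : HasDerivAt (fun s => η (flow A (-s) ((A ^ k) b)))
          (η (-(flow A (-s) * A) ((A ^ k) b))) s := by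
        have := ((hasDerivAt_flow_neg A s).clm_apply (hasDerivAt_const s ((A ^ k) b)))
        rw [map_zero, add_zero] at this
        exact η.hasFDerivAt.comp_hasDerivAt s this
      have h2 : HasDerivAt (fun s => η (flow A (-s) ((A ^ k) b))) 0 s :=
        (hasDerivAt_const s (0 : ℝ)).congr_of_eventuallyEq
          (by filter_upwards [isOpen_Ioo.mem_nhds hs] with r hr using ih r hr)
      simpa [pow_succ'] using h1.unique h2
  have hc : Continuous (fun s => η (flow A (-s) ((A ^ k) b))) :=
    η.continuous.comp (((continuous_flow A).comp continuous_neg).clm_apply continuous_const)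
  have hcl : closure (Ioo 0 t) ⊆ {s | η (flow A (-s) ((A ^ k) b)) = 0} :=
    closure_minimal (hk k) (isClosed_eq hc continuous_const)
  have := hcl (by rw [closure_Ioo ht.ne]; exact ⟨le_rfl, ht.le⟩ : (0 : ℝ) ∈ closure (Ioo 0 t))
  simpa using this

/-- A functional annihilating the range of the input-to-state map `f` kills every `exp(-sA) B u`
with `0 < s < t`, hence every `A ^ k B u`, hence `K`; so `K` lies in the range. The range is
finite-dimensional, so `f` has a bounded linear right inverse onto it, and small states are reached
by controls small in the sup norm, thus with values in `V`. -/
lemma exists_ball_subset_nullSet [FiniteDimensional ℝ E] (hV : (0 : F) ∈ interior V)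
    {K : Submodule ℝ E}
    (hK : ∀ η : E →L[ℝ] ℝ, (∀ (k : ℕ) (u : F), η ((A ^ k) (B u)) = 0) → ∀ x ∈ K, η x = 0)
    {t : ℝ} (ht : 0 < t) : ∃ δ > 0, ∀ x ∈ K, ‖x‖ ≤ δ → x ∈ nullSet A B V t := by
  have := FiniteDimensional.proper ℝ F
  have hcont : ∀ v : BoundedContinuousFunction ℝ F,
      IntervalIntegrable (fun s => response A B s (v s)) volume 0 t := fun v =>
    ((continuous_response A B).clm_apply v.continuous).intervalIntegrable _ _
  let f : BoundedContinuousFunction ℝ F →ₗ[ℝ] E :=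
    { toFun := fun v => ∫ s in (0 : ℝ)..t, response A B s (v s)
      map_add' := fun v w => by
        simp only [BoundedContinuousFunction.coe_add, Pi.add_apply, map_add]
        exact integral_add (hcont v) (hcont w)
      map_smul' := fun c v => by
        simp only [BoundedContinuousFunction.coe_smul, map_smul, RingHom.id_apply]
        exact intervalIntegral.integral_smul _ _ }
  have hKf : K ≤ LinearMap.range f := by
    intro x hx
    by_contra hn
    obtain ⟨η, hη, hker⟩ := Submodule.exists_le_ker_of_notMem hn
    refine hη (hK (LinearMap.toContinuousLinearMap η) (fun k u => ?_) x hx)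
    refine apply_pow_eq_zero_of_flow_neg ht (fun s hs => ?_) k
    set η' := LinearMap.toContinuousLinearMap η
    let g : ℝ → ℝ := fun s => η' (response A B s u)
    have hg : Continuous g :=
      η'.continuous.comp ((continuous_response A B).clm_apply continuous_const)
    -- Testing `η` on the input `g s • u` produces `∫ g²`, which forces `g = 0`. Extending the input
    -- constantly outside `[0, t]` keeps it bounded and continuous.
    let gc : C(Icc (0 : ℝ) t, F) := ⟨fun s => g s • u, by fun_prop⟩
    let v : BoundedContinuousFunction ℝ F :=
      (BoundedContinuousFunction.mkOfCompact gc).compContinuous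
        ⟨projIcc 0 t ht.le, continuous_projIcc⟩
    have hv : ∀ s ∈ Icc 0 t, v s = g s • u := fun s hs => by
      simp [v, gc, projIcc_of_mem ht.le hs]
    have h0 : η' (f v) = 0 := hker ⟨v, rfl⟩
    have h1 : η' (f v) = ∫ s in (0 : ℝ)..t, g s * g s := by
      change η' (∫ s in (0 : ℝ)..t, response A B s (v s)) = _
      rw [← ContinuousLinearMap.intervalIntegral_comp_comm _ (hcont v)]
      refine integral_congr fun s hs => ?_
      rw [uIcc_of_le ht.le] at hs
      simp [hv s hs, g]
    by_contra hne
    have hpos : 0 < ∫ s in (0 : ℝ)..t, g s * g s :=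
      integral_pos ht (hg.mul hg).continuousOn (fun s _ => mul_self_nonneg _)
        ⟨s, Ioo_subset_Icc_self hs, mul_self_pos.2 hne⟩
    linarith
  obtain ⟨g, hg⟩ := f.rangeRestrict.exists_rightInverse_of_surjective f.range_rangeRestrict
  obtain ⟨r, hr, hrV⟩ := Metric.mem_nhds_iff.1 (mem_interior_iff_mem_nhds.1 hV)
  let g' := LinearMap.toContinuousLinearMap g
  refine ⟨r / (‖g'‖ + 1) / 2, by positivity, fun x hx hxn => ?_⟩
  let y : LinearMap.range f := ⟨-x, (LinearMap.range f).neg_mem (hKf hx)⟩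
  refine ⟨g' y, ⟨(g' y).continuous.measurable, fun s => hrV ?_⟩, ?_⟩
  · rw [mem_ball_zero_iff]
    calc ‖g' y s‖ ≤ ‖g' y‖ := (g' y).norm_coe_le_norm s
      _ ≤ ‖g'‖ * ‖y‖ := g'.le_opNorm y
      _ ≤ (‖g'‖ + 1) * (r / (‖g'‖ + 1) / 2) := by
        gcongr
        · linarith
        · simpa [y] using hxn
      _ = r / 2 := by field_simp
      _ < r := by linarith
  · have := congrArg Subtype.val (LinearMap.congr_fun hg y)
    have h2 : f (g y) = -x := this
    rw [eq_neg_iff_add_eq_zero, add_comm, ← eq_neg_iff_add_eq_zero]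
    exact h2

end NullControllable

/-! ### Closedness of the null-controllable sets -/

section WeakCompactness

/-- A decreasing sequence of nonempty bounded closed convex subsets of a Hilbert space has a
common point. -/
lemma nonempty_iInter_of_convex {H : Type*} [NormedAddCommGroup H] [InnerProductSpace ℝ H]
    [CompleteSpace H] {K : ℕ → Set H} (hne : ∀ k, (K k).Nonempty) (hcl : ∀ k, IsClosed (K k))
    (hconv : ∀ k, Convex ℝ (K k)) (hanti : Antitone K) (hb : Bornology.IsBounded (K 0)) :
    (⋂ k, K k).Nonempty := by
  have hmin : ∀ k, ∃ v ∈ K k, ∀ w ∈ K k, ‖v‖ ≤ ‖w‖ := by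
    intro k
    obtain ⟨v, hv, hvm⟩ := exists_norm_eq_iInf_of_complete_convex (hne k)
      (hcl k).isComplete (hconv k) 0
    refine ⟨v, hv, fun w hw => ?_⟩
    rw [zero_sub, norm_neg] at hvm
    rw [hvm]
    have := ciInf_le (f := fun w : K k => ‖0 - (w : H)‖) ⟨0, by rintro _ ⟨w, rfl⟩; positivity⟩
      ⟨w, hw⟩
    simpa using this
  choose v hv hvm using hmin
  have hmono : Monotone fun k => ‖v k‖ ^ 2 := fun i j hij => by
    have := hvm i (v j) (hanti hij (hv j))
    dsimp only
    gcongr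
  obtain ⟨C, hC⟩ := hb.exists_norm_le
  have hbdd : BddAbove (range fun k => ‖v k‖ ^ 2) := by
    refine ⟨C ^ 2, ?_⟩
    rintro _ ⟨k, rfl⟩
    have := hC (v k) (hanti (Nat.zero_le k) (hv k))
    dsimp only
    gcongr
  have hcau := (tendsto_atTop_ciSup hmono hbdd).cauchySeq
  -- The midpoint of `v i` and `v j` lies in `K i`, so its norm is at least `‖v i‖`; the
  -- parallelogram law then makes the minimal-norm points a Cauchy sequence.
  have hkey : ∀ i j, i ≤ j → ‖v i - v j‖ ^ 2 ≤ 2 * (‖v j‖ ^ 2 - ‖v i‖ ^ 2) := by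
    intro i j hij
    have hmem : (1 / 2 : ℝ) • v i + (1 / 2 : ℝ) • v j ∈ K i :=
      hconv i (hv i) (hanti hij (hv j)) (by norm_num) (by norm_num) (by norm_num)
    have h1 := hvm i _ hmem
    rw [← smul_add, norm_smul] at h1
    have h2 := parallelogram_law_with_norm ℝ (v i) (v j)
    have h3 : 2 * ‖v i‖ ≤ ‖v i + v j‖ := by norm_num at h1; linarith
    nlinarith [norm_nonneg (v i)]
  have hv' : CauchySeq v := by
    rw [Metric.cauchySeq_iff'] at hcau ⊢
    intro ε hε
    obtain ⟨N, hN⟩ := hcau (ε ^ 2 / 2) (by positivity)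
    refine ⟨N, fun k hk => ?_⟩
    have h1 := hN k hk
    rw [Real.dist_eq] at h1
    have h2 := hkey N k hk
    rw [dist_comm, dist_eq_norm]
    have h3 := le_abs_self (‖v k‖ ^ 2 - ‖v N‖ ^ 2)
    exact lt_of_pow_lt_pow_left₀ 2 hε.le (by linarith)
  obtain ⟨x, hx⟩ := cauchySeq_tendsto_of_complete hv'
  refine ⟨x, mem_iInter.2 fun k => (hcl k).mem_of_tendsto hx ?_⟩
  filter_upwards [eventually_ge_atTop k] with j hj using hanti hj (hv j)

/-- Stands in for weak compactness of `S`: a limit point `y` of the image gives the decreasing sets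
of points of `S` whose images are within `1 / (k + 1)` of `y`, and a common point maps to `y`. -/
lemma isClosed_image_of_convex {H E : Type*} [NormedAddCommGroup H] [InnerProductSpace ℝ H]
    [CompleteSpace H] [NormedAddCommGroup E] [NormedSpace ℝ E] (T : H →L[ℝ] E) {S : Set H}
    (hcl : IsClosed S) (hconv : Convex ℝ S) (hb : Bornology.IsBounded S) :
    IsClosed (T '' S) := by
  refine isClosed_of_closure_subset fun y hy => ?_
  let K : ℕ → Set H := fun k => S ∩ T ⁻¹' Metric.closedBall y (1 / ((k : ℝ) + 1))
  obtain ⟨x, hx⟩ := nonempty_iInter_of_convex (K := K)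
    (fun k => by
      obtain ⟨_, ⟨x, hx, rfl⟩, h⟩ := Metric.mem_closure_iff.1 hy (1 / ((k : ℝ) + 1))
        (by positivity)
      exact ⟨x, hx, by simpa [dist_comm] using h.le⟩)
    (fun k => hcl.inter (Metric.isClosed_closedBall.preimage T.continuous))
    (fun k => hconv.inter ((convex_closedBall _ _).linear_preimage T.toLinearMap))
    (fun i j hij => inter_subset_inter_right _ (preimage_mono (Metric.closedBall_subset_closedBall
      (by gcongr))))
    (hb.subset inter_subset_left)
  rw [mem_iInter] at hx
  refine ⟨x, (hx 0).1, ?_⟩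
  refine dist_le_zero.1 (ge_of_tendsto' tendsto_one_div_add_atTop_nhds_zero_nat fun k => ?_)
  exact (hx k).2

lemma isClosed_setOf_ae_mem {α F : Type*} [MeasurableSpace α] {μ : Measure α}
    [NormedAddCommGroup F] {V : Set F} (hV : IsClosed V) :
    IsClosed {f : Lp F 2 μ | ∀ᵐ x ∂μ, f x ∈ V} := by
  refine isSeqClosed_iff_isClosed.1 fun f g hf hg => ?_
  obtain ⟨φ, -, hφ⟩ := (tendstoInMeasure_of_tendsto_Lp hg).exists_seq_tendsto_ae
  have hf' : ∀ᵐ x ∂μ, ∀ k, f k x ∈ V := ae_all_iff.2 hf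
  filter_upwards [hφ, hf'] with x h1 h2
  exact hV.mem_of_tendsto h1 (Eventually.of_forall fun k => h2 _)

/-- Integration against a bounded operator-valued weight, as a functional on `L²`. -/
lemma exists_clm_integral {α F E : Type*} [MeasurableSpace α] {μ : Measure α}
    [IsFiniteMeasure μ] [NormedAddCommGroup F] [NormedSpace ℝ F] [NormedAddCommGroup E]
    [NormedSpace ℝ E] {G : α → F →L[ℝ] E} (hG : AEStronglyMeasurable G μ) {C : ℝ}
    (hC : ∀ᵐ x ∂μ, ‖G x‖ ≤ C) :
    ∃ T : Lp F 2 μ →L[ℝ] E, ∀ f, T f = ∫ x, G x (f x) ∂μ := by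
  have hint : ∀ f : Lp F 2 μ, Integrable (fun x => G x (f x)) μ := fun f => by
    have hf : Integrable f μ := (Lp.memLp f).integrable (by norm_num)
    refine Integrable.mono' (hf.norm.const_mul C)
      ((ContinuousLinearMap.id ℝ (F →L[ℝ] E)).aestronglyMeasurable_comp₂ hG hf.1) ?_
    filter_upwards [hC] with x hx
    exact ((G x).le_opNorm _).trans (by gcongr)
  let T : Lp F 2 μ →ₗ[ℝ] E :=
    { toFun := fun f => ∫ x, G x (f x) ∂μ
      map_add' := fun f g => by
        rw [← integral_add (hint f) (hint g)]
        refine integral_congr_ae ?_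
        filter_upwards [Lp.coeFn_add f g] with x hx
        rw [hx, Pi.add_apply, map_add]
      map_smul' := fun c f => by
        rw [RingHom.id_apply, ← MeasureTheory.integral_smul]
        refine integral_congr_ae ?_
        filter_upwards [Lp.coeFn_smul c f] with x hx
        rw [hx, Pi.smul_apply, map_smul] }
  refine ⟨T.mkContinuous (|C| * (μ univ ^ (1 / 2 : ℝ)).toReal) fun f => ?_, fun f => rfl⟩
  have hf : Integrable f μ := (Lp.memLp f).integrable (by norm_num)
  have h1 : ∫ x, ‖f x‖ ∂μ ≤ (μ univ ^ (1 / 2 : ℝ)).toReal * ‖f‖ := by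
    have h := eLpNorm_le_eLpNorm_mul_rpow_measure_univ (μ := μ) (p := 1) (q := 2)
      (by norm_num) hf.1
    have hexp : (1 / ENNReal.toReal 1 - 1 / ENNReal.toReal 2 : ℝ) = 1 / 2 := by norm_num
    rw [hexp] at h
    have htop : μ univ ^ (1 / 2 : ℝ) ≠ ⊤ := by finiteness
    have h' := ENNReal.toReal_mono
      (ENNReal.mul_ne_top (Lp.memLp f).2.ne htop) h
    rw [ENNReal.toReal_mul] at h'
    rw [integral_norm_eq_lintegral_enorm hf.1, ← eLpNorm_one_eq_lintegral_enorm, Lp.norm_def,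
      mul_comm]
    exact h'
  calc ‖T f‖ ≤ ∫ x, |C| * ‖f x‖ ∂μ := by
        refine norm_integral_le_of_norm_le (hf.norm.const_mul _) ?_
        filter_upwards [hC] with x hx
        exact ((G x).le_opNorm _).trans (by gcongr; exact hx.trans (le_abs_self C))
    _ = |C| * ∫ x, ‖f x‖ ∂μ := integral_const_mul _ _
    _ ≤ _ := by rw [mul_assoc]; gcongr

variable {E F : Type*} [NormedAddCommGroup E] [NormedSpace ℝ E] [CompleteSpace E]
  [NormedAddCommGroup F] [NormedSpace ℝ F] [FiniteDimensional ℝ F] [MeasurableSpace F]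
  [BorelSpace F] {A : E →L[ℝ] E} {B : F →L[ℝ] E} {V : Set F}

omit [NormedSpace ℝ F] [FiniteDimensional ℝ F] in
/-- A control with values in `V` almost everywhere is almost everywhere equal to one with values
in `V` everywhere. -/
lemma exists_isAdmissible_ae_eq (hV : IsClosed V) (h0 : 0 ∈ V) {μ : Measure ℝ} {u : ℝ → F}
    (hu : AEStronglyMeasurable u μ) (huV : ∀ᵐ s ∂μ, u s ∈ V) :
    ∃ v, IsAdmissible V v ∧ u =ᵐ[μ] v := by
  classical
  have hm : Measurable (hu.mk u) := hu.stronglyMeasurable_mk.measurable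
  refine ⟨fun s => if hu.mk u s ∈ V then hu.mk u s else 0, ⟨Measurable.ite
    (hm hV.measurableSet) hm measurable_const, fun s => ?_⟩, ?_⟩
  · split_ifs with h
    exacts [h, h0]
  · filter_upwards [hu.ae_eq_mk, huV] with s h1 h2
    rw [h1] at h2
    simp [h1, h2]

lemma isClosed_nullSet (hconv : Convex ℝ V) (hV : IsCompact V) (h0 : 0 ∈ V) {t : ℝ}
    (ht : 0 ≤ t) : IsClosed (nullSet A B V t) := by
  have := FiniteDimensional.proper ℝ F
  -- The norm of `F` need not be Euclidean; passing to Euclidean coordinates makes `L²` a Hilbert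
  -- space, in which the `V`-valued controls form a closed bounded convex set.
  let e : F ≃L[ℝ] EuclideanSpace ℝ (Fin (Module.finrank ℝ F)) := toEuclidean
  let W : Set (EuclideanSpace ℝ (Fin (Module.finrank ℝ F))) := e.symm ⁻¹' V
  have hWcl : IsClosed W := hV.isClosed.preimage e.symm.continuous
  have hWconv : Convex ℝ W := hconv.linear_preimage e.symm.toLinearMap
  have hWb : ∃ C, ∀ w ∈ W, ‖w‖ ≤ C := by
    have : W = e '' V := by ext w; simp [W, ContinuousLinearEquiv.image_eq_preimage_symm]
    rw [this]
    exact (hV.image e.continuous).isBounded.exists_norm_le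
  obtain ⟨C, hC⟩ := hWb
  let G : ℝ → EuclideanSpace ℝ (Fin (Module.finrank ℝ F)) →L[ℝ] E := fun s =>
    (response A B s).comp (e.symm : _ →L[ℝ] F)
  have hG : Continuous G := (continuous_response A B).clm_comp continuous_const
  set μ : Measure ℝ := volume.restrict (Ioc 0 t) with hμ
  obtain ⟨M, hM⟩ := isCompact_Icc.exists_bound_of_continuousOn (s := Icc 0 t) hG.continuousOn
  obtain ⟨T, hT⟩ := exists_clm_integral (μ := μ) (C := M) hG.aestronglyMeasurable
    ((ae_restrict_iff' measurableSet_Ioc).2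
      (Eventually.of_forall fun s hs => hM s (Ioc_subset_Icc_self hs)))
  have hcl := isClosed_image_of_convex T (isClosed_setOf_ae_mem (μ := μ) hWcl) (by
      intro f hf g hg a b ha hb hab
      filter_upwards [hf, hg, Lp.coeFn_add (a • f) (b • g), Lp.coeFn_smul a f,
        Lp.coeFn_smul b g] with s h1 h2 h3 h4 h5
      rw [h3, Pi.add_apply, h4, h5]
      exact hWconv h1 h2 ha hb hab) (by
      refine (isBounded_iff_forall_norm_le).2 ⟨_, fun f hf => Lp.norm_le_of_ae_bound
        (C := |C|) (abs_nonneg _) ?_⟩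
      filter_upwards [hf] with s hs using (hC _ hs).trans (le_abs_self C))
  convert hcl.preimage (continuous_neg (G := E)) using 1
  ext z
  simp only [nullSet, mem_ofPred_eq, mem_preimage, mem_image, integral_of_le ht]
  constructor
  · rintro ⟨v, hv, rfl⟩
    have hmem : MemLp (fun s => e (v s)) 2 μ :=
      MemLp.of_bound (e.continuous.comp_aestronglyMeasurable hv.measurable.aestronglyMeasurable) C
        (Eventually.of_forall fun s => hC _ (by simpa [W] using hv.mem s))
    refine ⟨hmem.toLp _, ?_, ?_⟩
    · filter_upwards [hmem.coeFn_toLp] with s hs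
      rw [hs]
      simpa [W] using hv.mem s
    · rw [hT, neg_neg]
      refine integral_congr_ae ?_
      filter_upwards [hmem.coeFn_toLp] with s hs
      simp [hs, G]
  · rintro ⟨f, hf, hfz⟩
    obtain ⟨v, hv, hfv⟩ := exists_isAdmissible_ae_eq (μ := μ) hV.isClosed h0
      (e.symm.continuous.comp_aestronglyMeasurable (Lp.aestronglyMeasurable f)) hf
    refine ⟨v, hv, ?_⟩
    rw [eq_neg_iff_add_eq_zero, add_comm, ← eq_neg_iff_add_eq_zero, ← hfz, hT]
    refine integral_congr_ae ?_
    filter_upwards [hfv] with s hs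
    simp [← hs, G]

/-- Truncating at `t` a control that works until `t + d` moves the steered state by at most `M * C *
d`, so `z` is a limit of points of a closed set. -/
lemma mem_nullSet_of_forall_gt (hconv : Convex ℝ V) (hV : IsCompact V) (h0 : 0 ∈ V) {t : ℝ}
    (ht : 0 ≤ t) {z : E} (h : ∀ s > t, z ∈ nullSet A B V s) : z ∈ nullSet A B V t := by
  obtain ⟨C, hC⟩ := hV.isBounded.exists_norm_le
  obtain ⟨M, hM⟩ := isCompact_Icc.exists_bound_of_continuousOn (s := Icc 0 (t + 1))
    (continuous_response A B).continuousOn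
  have hM0 : 0 ≤ M := (norm_nonneg _).trans (hM 0 ⟨le_rfl, by linarith⟩)
  have hC0 : 0 ≤ C := (norm_nonneg _).trans (hC 0 h0)
  refine (isClosed_nullSet hconv hV h0 ht).closure_subset (Metric.mem_closure_iff.2 fun ε hε => ?_)
  set d := min 1 (ε / (M * C + 1) / 2) with hd
  have hd0 : 0 < d := by positivity
  obtain ⟨v, hv, hz⟩ := h (t + d) (by linarith)
  refine ⟨_, ⟨v, hv, rfl⟩, ?_⟩
  have hi := fun a b => hv.intervalIntegrable hV.isBounded (continuous_response A B) a b
  have hb : ‖∫ s in t..(t + d), response A B s (v s)‖ ≤ M * C * |t + d - t| := by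
    refine norm_integral_le_of_norm_le_const fun s hs => ?_
    rw [uIoc_of_le (by linarith)] at hs
    refine ((response A B s).le_opNorm _).trans ?_
    gcongr
    · exact hM s ⟨by linarith [hs.1], hs.2.trans (by gcongr; exact min_le_left _ _)⟩
    · exact hC _ (hv.mem s)
  rw [hz, ← integral_add_adjacent_intervals (hi 0 t) (hi t (t + d)), dist_eq_norm]
  rw [add_sub_cancel_left, abs_of_pos hd0] at hb
  calc _ = ‖∫ s in t..(t + d), response A B s (v s)‖ := by
        rw [← norm_neg]; congr 1; abel
    _ ≤ M * C * d := hb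
    _ ≤ (M * C + 1) * (ε / (M * C + 1) / 2) := by
        gcongr
        · linarith
        · exact min_le_right _ _
    _ = ε / 2 := by field_simp
    _ < ε := by linarith

end WeakCompactness

/-! ### Global steering by a divergent series -/

section Steering

variable {E F : Type*} [NormedAddCommGroup E] [NormedSpace ℝ E] [FiniteDimensional ℝ E]
  [CompleteSpace E] [NormedAddCommGroup F] [NormedSpace ℝ F] [FiniteDimensional ℝ F]
  [MeasurableSpace F] [BorelSpace F] {A : E →L[ℝ] E} {B : F →L[ℝ] E} {V : Set F}
  {K : Submodule ℝ E}

/-- A state whose free trajectory grows at most linearly is steered to the origin by spending at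
time `j` a fraction proportional to `1 / (j + 1)` of the local control authority; this suffices
because the harmonic series diverges. -/
lemma exists_mem_nullSet (hconv : Convex ℝ V) (hVb : Bornology.IsBounded V)
    (hV0 : (0 : F) ∈ interior V) (hA : ∀ x ∈ K, A x ∈ K)
    (hK : ∀ η : E →L[ℝ] ℝ, (∀ (k : ℕ) (u : F), η ((A ^ k) (B u)) = 0) → ∀ x ∈ K, η x = 0)
    {x : E} (hx : x ∈ K) {C : ℝ} (hC : ∀ k : ℕ, ‖flow A k x‖ ≤ C * (k + 1)) :
    ∃ t, 0 ≤ t ∧ x ∈ nullSet A B V t := by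
  have h0 := interior_subset hV0
  obtain ⟨δ, hδ, hball⟩ := exists_ball_subset_nullSet hV0 hK one_pos
  set C' := max C 1 with hC'
  have hC'0 : 0 < C' := by positivity
  -- With this choice the share `c / (k + 1)` times the growth bound `C' * (k + 1)` is exactly the
  -- radius `δ`.
  set c : ℝ := δ / C' with hc
  have hc0 : 0 < c := by positivity
  set S : ℕ → ℝ := fun k => ∑ j ∈ Finset.range k, 1 / ((j : ℝ) + 1) with hS
  have hmem : ∀ k : ℕ, (c * S k) • x ∈ nullSet A B V k := by
    intro k
    induction k with
    | zero => simpa [hS] using zero_mem_nullSet (A := A) (B := B) h0 0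
    | succ k ih =>
      have hstep : (c * (1 / ((k : ℝ) + 1))) • flow A k x ∈ nullSet A B V 1 := by
        refine hball _ (K.smul_mem _ (flow_mem hA _ hx)) ?_
        rw [norm_smul, Real.norm_of_nonneg (by positivity)]
        calc c * (1 / ((k : ℝ) + 1)) * ‖flow A k x‖
            ≤ c * (1 / ((k : ℝ) + 1)) * (C' * (k + 1)) := by
              gcongr
              exact (hC k).trans (by gcongr; exact le_max_left _ _)
          _ = δ := by rw [hc]; field_simp
      have h := add_flow_mem_nullSet hVb (Nat.cast_nonneg k) zero_le_one ih hstep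
      rw [map_smul, flow_neg_apply_flow, ← add_smul, ← mul_add] at h
      simpa [hS, Finset.sum_range_succ] using h
  obtain ⟨k, hk⟩ := (Real.tendsto_sum_range_one_div_nat_succ_atTop.eventually_ge_atTop
    (1 / c)).exists
  have hk' : 1 ≤ c * S k := by
    rw [div_le_iff₀ hc0] at hk
    rw [mul_comm]; exact hk
  refine ⟨k, Nat.cast_nonneg k, ?_⟩
  -- A multiple of `x` by a factor at least 1 has been steered; convexity with 0 scales back to `x`.
  have h := (convex_nullSet (A := A) (B := B) hconv hVb k).smul_mem_of_zero_mem
    (zero_mem_nullSet h0 _) (hmem k) (t := (c * S k)⁻¹)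
    ⟨by positivity, inv_le_one_of_one_le₀ hk'⟩
  rwa [smul_smul, inv_mul_cancel₀ (by positivity), one_smul] at h

end Steering

/-! ### The Kalman subspace -/

section Kalman

open PHControl

variable {n m : ℕ}

/-- The continuous linear map `x ↦ M *ᵥ x`. -/
noncomputable def mulVecCLM {k l : ℕ} (M : Matrix (Fin k) (Fin l) ℝ) :
    (Fin l → ℝ) →L[ℝ] (Fin k → ℝ) :=
  LinearMap.toContinuousLinearMap M.mulVecLin

@[simp] lemma mulVecCLM_apply {k l : ℕ} (M : Matrix (Fin k) (Fin l) ℝ) (x : Fin l → ℝ) :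
    mulVecCLM M x = M *ᵥ x := rfl

lemma mulVecCLM_pow_apply (A : Matrix (Fin n) (Fin n) ℝ) (k : ℕ) (x : Fin n → ℝ) :
    (mulVecCLM A ^ k) x = (A ^ k) *ᵥ x := by
  induction k generalizing x with
  | zero => simp
  | succ k ih =>
    rw [pow_succ, pow_succ, mul_apply_eq_comp, ih, mulVecCLM_apply, Matrix.mulVec_mulVec]

/-- The range of the Kalman matrix, the controllable subspace. -/
noncomputable def controllableSubspace (A : Matrix (Fin n) (Fin n) ℝ)
    (B : Matrix (Fin n) (Fin m) ℝ) : Submodule ℝ (Fin n → ℝ) :=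
  LinearMap.range (kalmanMatrix A B).mulVecLin

variable {A : Matrix (Fin n) (Fin n) ℝ} {B : Matrix (Fin n) (Fin m) ℝ}

lemma controllableSubspace_induction {p : (Fin n → ℝ) → Prop}
    (hmem : ∀ (k : ℕ) (u : Fin m → ℝ), p ((A ^ k) *ᵥ (B *ᵥ u)))
    (hadd : ∀ x y, p x → p y → p (x + y)) (hsmul : ∀ (c : ℝ) x, p x → p (c • x))
    (hzero : p 0) {x : Fin n → ℝ} (hx : x ∈ controllableSubspace A B) : p x := by
  rw [controllableSubspace, Matrix.range_mulVecLin] at hx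
  induction hx using Submodule.span_induction with
  | mem x h =>
    obtain ⟨q, rfl⟩ := h
    have := hmem q.1 (Pi.single q.2 1)
    convert this using 1
    ext i
    rw [Matrix.mulVec_mulVec, Matrix.mulVec_single_one]
    rfl
  | zero => exact hzero
  | add x y _ _ hx hy => exact hadd x y hx hy
  | smul c x _ hx => exact hsmul c x hx

lemma pow_mulVec_mem_of_lt {k : ℕ} (hk : k < n) (u : Fin m → ℝ) :
    (A ^ k) *ᵥ (B *ᵥ u) ∈ controllableSubspace A B := by
  refine ⟨fun q => if q.1 = ⟨k, hk⟩ then u q.2 else 0, ?_⟩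
  ext i
  rw [Matrix.mulVec_mulVec, Matrix.mulVecLin_apply]
  simp only [Matrix.mulVec, dotProduct, kalmanMatrix, Matrix.of_apply, Fintype.sum_prod_type,
    mul_ite, mul_zero]
  rw [Finset.sum_comm]
  simp

/-- By Cayley-Hamilton, `A ^ k` is a combination of powers below `n`. -/
lemma pow_mulVec_mem (k : ℕ) (u : Fin m → ℝ) :
    (A ^ k) *ᵥ (B *ᵥ u) ∈ controllableSubspace A B := by
  rcases Nat.eq_zero_or_pos n with rfl | hn
  · rw [Subsingleton.elim ((A ^ k) *ᵥ (B *ᵥ u)) 0]; exact Submodule.zero_mem _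
  have hne : A.charpoly ≠ 1 := fun h => by
    have := A.charpoly_natDegree_eq_dim
    rw [h] at this
    simp at this
    omega
  have hdeg := Polynomial.natDegree_modByMonic_lt (Polynomial.X ^ k) A.charpoly_monic hne
  rw [A.charpoly_natDegree_eq_dim, Fintype.card_fin] at hdeg
  rw [A.pow_eq_aeval_mod_charpoly k, Polynomial.aeval_eq_sum_range' hdeg, Matrix.sum_mulVec]
  refine Submodule.sum_mem _ fun i hi => ?_
  rw [Matrix.smul_mulVec]
  exact Submodule.smul_mem _ _ (pow_mulVec_mem_of_lt (Finset.mem_range.1 hi) u)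

lemma mulVec_mem_controllableSubspace (x : Fin n → ℝ) (hx : x ∈ controllableSubspace A B) :
    mulVecCLM A x ∈ controllableSubspace A B := by
  refine controllableSubspace_induction (p := fun x => mulVecCLM A x ∈ controllableSubspace A B)
    (fun k u => ?_) (fun x y hx hy => ?_) (fun c x hx => ?_) ?_ hx
  · have := pow_mulVec_mem (A := A) (B := B) (k + 1) u
    rwa [pow_succ', ← Matrix.mulVec_mulVec] at this
  · rw [map_add]; exact Submodule.add_mem _ hx hy
  · rw [map_smul]; exact Submodule.smul_mem _ _ hx
  · rw [map_zero]; exact Submodule.zero_mem _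

lemma controllableSubspace_annihilator (η : (Fin n → ℝ) →L[ℝ] ℝ)
    (h : ∀ (k : ℕ) (u : Fin m → ℝ), η ((mulVecCLM A ^ k) (mulVecCLM B u)) = 0)
    (x : Fin n → ℝ) (hx : x ∈ controllableSubspace A B) : η x = 0 := by
  refine controllableSubspace_induction (p := fun x => η x = 0) (fun k u => ?_)
    (fun x y hx hy => ?_) (fun c x hx => ?_) (map_zero η) hx
  · rw [← mulVecCLM_pow_apply]; exact h k u
  · simp [hx, hy]
  · simp [hx]

end Kalman

/-! ### Linear growth from energy dissipation -/

section Growth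

open PHControl Matrix
open scoped MatrixOrder

variable {n m : ℕ}

/-- Along free trajectories the energy `xᵀ Q x` does not increase, so the velocity
`(J - R) Q x` stays bounded and the state grows at most linearly. -/
lemma exists_norm_flow_drift_le (sys : PHSystem n m) (x : Fin n → ℝ) :
    ∃ C : ℝ, ∀ k : ℕ, ‖flow (mulVecCLM sys.drift) k x‖ ≤ C * (k + 1) := by
  set A := mulVecCLM sys.drift with hA
  set y : ℝ → Fin n → ℝ := fun s => flow A s x with hy
  have hQ : sys.Qᵀ = sys.Q := sys.Q_psd.1
  have hder : ∀ s, HasDerivAt y ((sys.J - sys.R) *ᵥ (sys.Q *ᵥ y s)) s := fun s => by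
    have h := (hasDerivAt_flow A s).clm_apply (hasDerivAt_const s x)
    rw [map_zero, add_zero, mul_apply_eq_comp, hA, mulVecCLM_apply, PHSystem.drift,
      ← mulVec_mulVec] at h
    exact h
  have hJ : ∀ q : Fin n → ℝ, q ⬝ᵥ (sys.J *ᵥ q) = 0 := fun q => by
    have h : q ⬝ᵥ (sys.J *ᵥ q) = -(q ⬝ᵥ (sys.J *ᵥ q)) := by
      conv_lhs => rw [sys.J_skew, neg_mulVec, dotProduct_neg, mulVec_transpose,
        dotProduct_comm, ← dotProduct_mulVec]
    linarith
  have henergy : ∀ s, HasDerivAt (fun s => y s ⬝ᵥ (sys.Q *ᵥ y s))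
      (-2 * ((sys.Q *ᵥ y s) ⬝ᵥ (sys.R *ᵥ (sys.Q *ᵥ y s)))) s := fun s => by
    set v := (sys.J - sys.R) *ᵥ (sys.Q *ᵥ y s) with hv
    have h1 : HasDerivAt (fun s => sys.Q *ᵥ y s) (sys.Q *ᵥ v) s :=
      (mulVecCLM sys.Q).hasFDerivAt.comp_hasDerivAt s (hder s)
    have h2 : HasDerivAt (fun s => ∑ i, y s i * (sys.Q *ᵥ y s) i)
        (∑ i, (v i * (sys.Q *ᵥ y s) i + y s i * (sys.Q *ᵥ v) i)) s :=
      HasDerivAt.fun_sum fun i _ => (hasDerivAt_pi.1 (hder s) i).mul (hasDerivAt_pi.1 h1 i)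
    refine HasDerivAt.congr_deriv h2 ?_
    rw [Finset.sum_add_distrib]
    change v ⬝ᵥ (sys.Q *ᵥ y s) + y s ⬝ᵥ (sys.Q *ᵥ v) = _
    have h3 : y s ⬝ᵥ (sys.Q *ᵥ v) = (sys.Q *ᵥ y s) ⬝ᵥ v := by
      rw [dotProduct_mulVec, ← mulVec_transpose, hQ]
    rw [h3, dotProduct_comm v, hv, sub_mulVec, dotProduct_sub, hJ]
    ring
  have hR : ∀ q : Fin n → ℝ, 0 ≤ q ⬝ᵥ (sys.R *ᵥ q) := fun q => by
    simpa using sys.R_psd.dotProduct_mulVec_nonneg q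
  have hanti : Antitone fun s => y s ⬝ᵥ (sys.Q *ᵥ y s) :=
    antitone_of_hasDerivAt_nonpos henergy fun s => by
      have := hR (sys.Q *ᵥ y s)
      rw [Pi.zero_apply]
      linarith
  -- Writing `Q = Nᵀ N`, the energy is the Euclidean square of `N y`. Even if `Q` is singular this
  -- bounds `Q y`, and so the velocity, though not `y` itself.
  obtain ⟨N, hN⟩ := CStarAlgebra.nonneg_iff_eq_star_mul_self.mp
    sys.Q_psd.nonneg
  rw [star_eq_conjTranspose] at hN
  set c := y 0 ⬝ᵥ (sys.Q *ᵥ y 0) with hc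
  have hNy : ∀ s, 0 ≤ s → ‖N *ᵥ y s‖ ≤ √c := fun s hs => by
    refine (pi_norm_le_iff_of_nonneg (Real.sqrt_nonneg _)).2 fun i => ?_
    refine Real.abs_le_sqrt ?_
    have h : y s ⬝ᵥ (sys.Q *ᵥ y s) = (N *ᵥ y s) ⬝ᵥ (N *ᵥ y s) := by
      rw [hN, conjTranspose_eq_transpose_of_trivial, ← mulVec_mulVec, mulVec_transpose,
        dotProduct_comm, ← dotProduct_mulVec]
    have h' := hanti hs
    dsimp only at h'
    rw [h] at h'
    refine le_trans ?_ h'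
    rw [sq]
    exact Finset.single_le_sum (f := fun i => (N *ᵥ y s) i * (N *ᵥ y s) i)
      (fun i _ => mul_self_nonneg _) (Finset.mem_univ i)
  set L := mulVecCLM ((sys.J - sys.R) * Nᵀ) with hL
  have hvel : ∀ s, 0 ≤ s → ‖(sys.J - sys.R) *ᵥ (sys.Q *ᵥ y s)‖ ≤ ‖L‖ * √c := fun s hs => by
    have : (sys.J - sys.R) *ᵥ (sys.Q *ᵥ y s) = L (N *ᵥ y s) := by
      rw [hL, mulVecCLM_apply, hN, conjTranspose_eq_transpose_of_trivial, mulVec_mulVec,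
        mulVec_mulVec, Matrix.mul_assoc]
    rw [this]
    exact (L.le_opNorm _).trans (by gcongr; exact hNy s hs)
  refine ⟨‖x‖ + ‖L‖ * √c, fun k => ?_⟩
  have hk : (0 : ℝ) ≤ k := Nat.cast_nonneg k
  have hmv := norm_image_sub_le_of_norm_deriv_le_segment' (f := y) (a := 0) (b := k)
    (fun s _ => (hder s).hasDerivWithinAt) (fun s hs => hvel s hs.1) k ⟨hk, le_rfl⟩
  have hy0 : y 0 = x := by simp [hy]
  rw [hy0, sub_zero] at hmv
  have := norm_le_insert' (y k) x
  have h3 : 0 ≤ ‖L‖ * √c := by positivity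
  change ‖y k‖ ≤ _
  nlinarith [norm_nonneg x]

end Growth

/-! ### Reachability and the shifted null-controllable sets -/

section Reachability

open PHControl

variable {n m : ℕ} {sys : PHSystem n m} {U : Set (Fin m → ℝ)} {xe : Fin n → ℝ} {ue : Fin m → ℝ}

/-- The states steered to the origin by controls `v` with `v + ue ∈ U`. -/
def shiftedNullSet (sys : PHSystem n m) (U : Set (Fin m → ℝ)) (ue : Fin m → ℝ) (t : ℝ) :
    Set (Fin n → ℝ) :=
  nullSet (mulVecCLM sys.drift) (mulVecCLM sys.input) ((· + ue) ⁻¹' U) t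

lemma drift_add_input (hss : sys.drift *ᵥ xe + sys.input *ᵥ ue = 0) (x : Fin n → ℝ)
    (u : Fin m → ℝ) :
    sys.drift *ᵥ x + sys.input *ᵥ u =
      mulVecCLM sys.drift (x - xe) + mulVecCLM sys.input (u - ue) := by
  rw [map_sub, map_sub]
  simp only [mulVecCLM_apply]
  rw [sub_add_sub_comm, hss, sub_zero]

lemma mem_shiftedNullSet_of_reachable (hUcl : IsClosed U)
    (hss : sys.IsSteadyState U xe ue) {t : ℝ} {x₀ : Fin n → ℝ}
    (h : sys.Reachable U t x₀ xe) : x₀ - xe ∈ shiftedNullSet sys U ue t := by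
  obtain ⟨ht, u, x, ⟨hu, huU⟩, ⟨hxc, hx⟩, hxt⟩ := h
  set A := mulVecCLM sys.drift with hA
  set B := mulVecCLM sys.input with hB
  set g : ℝ → Fin n → ℝ := fun τ => sys.drift *ᵥ x τ + sys.input *ᵥ u τ with hg
  have hu' : IntervalIntegrable u volume 0 t :=
    (intervalIntegrable_iff_integrableOn_Ioo_of_le ht).2 hu
  have hgi : IntervalIntegrable g volume 0 t := by
    refine IntervalIntegrable.add (ContinuousOn.intervalIntegrable ?_) ?_
    · rw [uIcc_of_le ht]
      exact A.continuous.comp_continuousOn hxc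
    · rw [intervalIntegrable_iff] at hu' ⊢
      exact B.integrable_comp hu'
  have hz : ∀ s ∈ Icc 0 t, x s - xe = (x₀ - xe) + ∫ τ in (0 : ℝ)..s, g τ := fun s hs => by
    rw [hx s hs]; abel
  -- Applying `exp(-sA)` to `x - xe` cancels the drift, leaving only the response to `u - ue`.
  have hprod := clm_apply_integral_eq (M := fun s => flow A (-s)) (c := x₀ - xe)
    (hasDerivAt_flow_neg A) (((((continuous_flow A).comp continuous_neg).mul
      continuous_const)).neg) hgi
  rw [← hz t ⟨ht, le_rfl⟩, hxt, sub_self, map_zero, neg_zero, flow_zero,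
    one_apply_eq_self] at hprod
  have hmeas : AEStronglyMeasurable (fun s => u s - ue) (volume.restrict (Ioo 0 t)) :=
    hu.aestronglyMeasurable.sub aestronglyMeasurable_const
  obtain ⟨v, hv, hvu⟩ := exists_isAdmissible_ae_eq (V := (· + ue) ⁻¹' U)
    (hUcl.preimage (continuous_add_const ue)) (by simpa using hss.1) hmeas
    (by filter_upwards [huU] with s hs; simpa using hs)
  refine ⟨v, hv, ?_⟩
  rw [eq_neg_iff_add_eq_zero, hprod]
  congr 1
  rw [integral_of_le ht, integral_of_le ht,
    integral_Ioc_eq_integral_Ioo, integral_Ioc_eq_integral_Ioo]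
  refine setIntegral_congr_ae measurableSet_Ioo ?_
  rw [← ae_restrict_iff' measurableSet_Ioo]
  filter_upwards [hvu, ae_restrict_mem measurableSet_Ioo] with s hs hs'
  rw [← hz s (Ioo_subset_Icc_self hs'), hg]
  dsimp only
  rw [drift_add_input hss.2, ← hs]
  simp [response, hA]

lemma reachable_of_mem_shiftedNullSet (hUb : Bornology.IsBounded U)
    (hss : sys.IsSteadyState U xe ue) {t : ℝ} (ht : 0 ≤ t) {x₀ : Fin n → ℝ}
    (h : x₀ - xe ∈ shiftedNullSet sys U ue t) : sys.Reachable U t x₀ xe := by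
  obtain ⟨v, hv, hx₀⟩ := h
  set A := mulVecCLM sys.drift with hA
  set B := mulVecCLM sys.input with hB
  have hVb : Bornology.IsBounded ((· + ue) ⁻¹' U) := by
    obtain ⟨C, hC⟩ := hUb.exists_norm_le
    refine isBounded_iff_forall_norm_le.2 ⟨C + ‖ue‖, fun w hw => ?_⟩
    have h1 := hC _ hw
    have h2 := norm_sub_le (w + ue) ue
    rw [add_sub_cancel_right] at h2
    linarith
  have hi := fun a b => hv.intervalIntegrable hVb (continuous_response A B) a b
  -- The trajectory is `exp(sA) w(s) + xe`, and `w t = 0` is exactly the membership of `x₀ - xe`.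
  set w : ℝ → Fin n → ℝ := fun s => (x₀ - xe) + ∫ τ in (0 : ℝ)..s, response A B τ (v τ) with hw
  have hwc : Continuous w := continuous_const.add (continuous_primitive hi 0)
  have hu : IsAdmissible U (fun s => v s + ue) := ⟨hv.measurable.add_const ue, hv.mem⟩
  refine ⟨ht, fun s => v s + ue, fun s => flow A s (w s) + xe,
    ⟨hu.integrableOn hUb (by simp), Eventually.of_forall hu.mem⟩,
    ⟨(((continuous_flow A).clm_apply hwc).add continuous_const).continuousOn, fun s _ => ?_⟩, ?_⟩
  · have hprod := clm_apply_integral_eq (c := x₀ - xe) (hasDerivAt_flow A)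
      (continuous_const.mul (continuous_flow A)) (hi 0 s)
    rw [flow_zero, one_apply_eq_self] at hprod
    have : ∀ τ, sys.drift *ᵥ (flow A τ (w τ) + xe) + sys.input *ᵥ (v τ + ue) =
        (A * flow A τ) (w τ) + flow A τ (response A B τ (v τ)) := fun τ => by
      rw [drift_add_input hss.2]
      simp [response, hA, hB]
    simp only [this]
    rw [show w s = (x₀ - xe) + ∫ τ in (0 : ℝ)..s, response A B τ (v τ) from rfl, hprod]
    abel
  · have : w t = 0 := by simp only [hw]; rw [hx₀]; simp
    simp [this]

end Reachability

end LinearControl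

/-! ### The theorem: steerable set, minimal time and its continuity -/

open PHControl LinearControl in
theorem corollaryc {n m : ℕ} (sys : PHControl.PHSystem n m)
    (U : Set (Fin m → ℝ)) (hUconv : Convex ℝ U) (hUcomp : IsCompact U)
    (hU0 : (0 : Fin m → ℝ) ∈ interior U)
    (xe : Fin n → ℝ) (ue : Fin m → ℝ)
    (hss : sys.IsSteadyState U xe ue) (hue : ue ∈ interior U) :
    sys.steerableTo U xe =
        (fun z => xe + z) ''
          (LinearMap.range (PHControl.kalmanMatrix sys.drift sys.input).mulVecLin :
            Set (Fin n → ℝ)) ∧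
      (∀ x₀ ∈ sys.steerableTo U xe,
        IsLeast {t : ℝ | sys.Reachable U t x₀ xe} (sys.minTime U xe x₀)) ∧
      ContinuousOn (sys.minTime U xe) (sys.steerableTo U xe) := by
  set V : Set (Fin m → ℝ) := (· + ue) ⁻¹' U with hVdef
  have hVconv : Convex ℝ V := hUconv.translate_preimage_left ue
  have hVcomp : IsCompact V := (Homeomorph.addRight ue).isCompact_preimage.2 hUcomp
  have hV0i : (0 : Fin m → ℝ) ∈ interior V := by
    have h := (Homeomorph.addRight ue).preimage_interior U
    rw [hVdef]
    refine h.subset ?_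
    simpa using hue
  have hV0 : (0 : Fin m → ℝ) ∈ V := interior_subset hV0i
  have hVb := hVcomp.isBounded
  set A := mulVecCLM sys.drift with hA
  set B := mulVecCLM sys.input with hB
  set K := controllableSubspace sys.drift sys.input with hK
  have hKA : ∀ x ∈ K, A x ∈ K := mulVec_mem_controllableSubspace
  have hKB : ∀ u, B u ∈ K := fun u => by
    have h := pow_mulVec_mem (A := sys.drift) (B := sys.input) 0 u
    rwa [pow_zero, Matrix.one_mulVec] at h
  have hKd : ∀ η : (Fin n → ℝ) →L[ℝ] ℝ, (∀ (k : ℕ) (u : Fin m → ℝ), η ((A ^ k) (B u)) = 0) →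
      ∀ x ∈ K, η x = 0 := controllableSubspace_annihilator
  have hreach : ∀ t x₀, sys.Reachable U t x₀ xe ↔ 0 ≤ t ∧ x₀ - xe ∈ nullSet A B V t :=
    fun t x₀ => ⟨fun h => ⟨h.1, mem_shiftedNullSet_of_reachable hUcomp.isClosed hss h⟩,
      fun h => reachable_of_mem_shiftedNullSet hUcomp.isBounded hss h.1 h.2⟩
  have hsteer : ∀ x₀, x₀ ∈ sys.steerableTo U xe ↔ x₀ - xe ∈ K := fun x₀ => by
    constructor
    · rintro ⟨t, ht⟩
      exact nullSet_subset hVb hKA hKB t ((hreach t x₀).1 ht).2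
    · intro h
      obtain ⟨C, hC⟩ := exists_norm_flow_drift_le sys (x₀ - xe)
      obtain ⟨t, ht⟩ := exists_mem_nullSet hVconv hVb hV0i hKA hKd h hC
      exact ⟨t, (hreach t x₀).2 ht⟩
  have hbdd : ∀ x₀, BddBelow {t : ℝ | sys.Reachable U t x₀ xe} := fun x₀ => ⟨0, fun t ht => ht.1⟩
  have hleast : ∀ x₀ ∈ sys.steerableTo U xe,
      IsLeast {t : ℝ | sys.Reachable U t x₀ xe} (sys.minTime U xe x₀) := fun x₀ hx₀ => by
    refine ⟨?_, fun t ht => csInf_le (hbdd x₀) ht⟩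
    have hT0 : 0 ≤ sys.minTime U xe x₀ := le_csInf hx₀ fun t ht => ht.1
    refine (hreach _ _).2 ⟨hT0, mem_nullSet_of_forall_gt hVconv hVcomp hV0 hT0 fun s hs => ?_⟩
    obtain ⟨r, hr, hrs⟩ := exists_lt_of_csInf_lt hx₀ hs
    obtain ⟨hr0, hrm⟩ := (hreach _ _).1 hr
    exact nullSet_mono hVb hV0 hr0 hrs.le hrm
  refine ⟨?_, hleast, ?_⟩
  · ext x₀
    rw [hsteer, mem_image]
    constructor
    · intro h
      exact ⟨x₀ - xe, h, by abel⟩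
    · rintro ⟨z, hz, rfl⟩
      rw [add_sub_cancel_left]
      exact hz
  · intro x₀ hx₀
    set T := sys.minTime U xe x₀ with hT
    obtain ⟨hT0, hTm⟩ := (hreach _ _).1 (hleast x₀ hx₀).1
    refine Metric.tendsto_nhds.2 fun ε hε => ?_
    -- Driving `y` with the optimal control of `x₀` leaves at time `T` the error `exp(TA)(y - x₀)`,
    -- a small vector of `K`, removable within a further time `ε / 2`.
    have hupper : ∀ᶠ y in 𝓝[sys.steerableTo U xe] x₀, sys.minTime U xe y ≤ T + ε / 2 := by
      obtain ⟨δ, hδ, hball⟩ := exists_ball_subset_nullSet (A := A) (B := B) hV0i hKd (half_pos hε)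
      have hcont : Tendsto (fun y => ‖flow A T (y - x₀)‖) (𝓝[sys.steerableTo U xe] x₀) (𝓝 0) := by
        have : Continuous fun y => ‖flow A T (y - x₀)‖ := by fun_prop
        simpa using (this.tendsto x₀).mono_left nhdsWithin_le_nhds
      filter_upwards [hcont.eventually_le_const hδ, self_mem_nhdsWithin] with y hy hyC
      have hyK : y - x₀ ∈ K := by
        simpa using K.sub_mem ((hsteer y).1 hyC) ((hsteer x₀).1 hx₀)
      have h := add_flow_mem_nullSet hVb hT0 (half_pos hε).le hTm
        (hball _ (flow_mem hKA T hyK) hy)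
      rw [flow_neg_apply_flow, sub_add_sub_comm, add_comm x₀, add_sub_add_right_eq_sub] at h
      exact csInf_le (hbdd y) ((hreach _ _).2 ⟨by positivity, h⟩)
    -- By minimality `x₀ - xe` is outside the closed set at time `T - ε`, so nearby states are too;
    -- monotonicity in time excludes all earlier times as well.
    have hlower : ∀ᶠ y in 𝓝[sys.steerableTo U xe] x₀, T - ε < sys.minTime U xe y := by
      rcases lt_or_ge (T - ε) 0 with hneg | hpos
      · filter_upwards [self_mem_nhdsWithin] with y hy
        exact hneg.trans_le (hleast y hy).1.1
      · have hnot : x₀ - xe ∉ nullSet A B V (T - ε) := fun h => by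
          have := (hleast x₀ hx₀).2 ((hreach _ _).2 ⟨hpos, h⟩)
          linarith
        have hopen : IsOpen {y | y - xe ∉ nullSet A B V (T - ε)} :=
          (isClosed_nullSet hVconv hVcomp hV0 hpos).isOpen_compl.preimage
            (continuous_id.sub continuous_const)
        filter_upwards [self_mem_nhdsWithin, nhdsWithin_le_nhds (hopen.mem_nhds hnot)]
          with y hy hyn
        by_contra hle
        obtain ⟨h0, hm⟩ := (hreach _ _).1 (hleast y hy).1
        exact hyn (nullSet_mono hVb hV0 h0 (not_lt.1 hle) hm)
    filter_upwards [hupper, hlower] with y h1 h2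
    rw [Real.dist_eq, abs_lt]
    constructor <;> linarith
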